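/- All trees are finite, rooted and plane, i.e. the children of each node are linearly ordered from left to right. A tree is regarded as a poset on its nodes in which $x\le y$ if and only if $y=x$ or $y$ is an ancestor of $x$, so that the root is the maximum. An embedding of $S$ into $T$ is a subposet $P$ of $T$ that is isomorphic to $S$ in such a way that the left-to-right order of the children of each node of $S$ is inherited from $T$; it is good if it contains the root of $T$. Let $a_T(S)$ and $g_T(S)$ be the number of all embeddings and of good embeddings of $S$ into $T$, and write $S\subseteq T$ if $a_T(S)\ge 1$. Let $\mathcal B_n$ be the set of plane binary trees (every node has $0$ or $2$ children) with $n$ nodes, and put $a_{\mathcal B_n}(S)=\sum_{T\in\mathcal B_n}a_T(S)$ and $g_{\mathcal B_n}(S)=\sum_{T\in\mathcal B_n}g_T(S)$. **Theorem.** Let $S_1,S_2$ be rooted plane trees with $S_1\subseteq S_2$. Then $a_{\mathcal B_n}(S_1)$ and $a_{\mathcal B_n}(S_2)$ are positive for all sufficiently large odd $n$, both limits below exist in $\mathbb R$, and $$\lim_{\substack{n\to\infty\\ n\text{ odd}}}\sqrt n\,\frac{g_{\mathcal B_n}(S_1)}{a_{\mathcal B_n}(S_1)}\;\le\;\lim_{\substack{n\to\infty\\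 n\text{ odd}}}\sqrt n\,\frac{g_{\mathcal B_n}(S_2)}{a_{\mathcal B_n}(S_2)}.$$ -/

import Mathlib

/-- Finite rooted plane trees: a root together with the ordered list of the subtrees
of its children. -/
inductive PlaneTree : Type where
  | node : List PlaneTree → PlaneTree

namespace PlaneTree

/-- `T.IsNode p` says that the address `p` is a node of `T`. The root has address `[]`, and
`i :: p` is the node with address `p` of the `i`-th subtree (from left to right, from `0`). -/
def IsNode : PlaneTree → List ℕ → Prop
  | _, [] => True
  | node ts, i :: p => ∃ h : i < ts.length, IsNode (ts[i]) p

/-- The nodes of a plane tree. -/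
@[ext]
structure Vertex (T : PlaneTree) : Type where
  address : List ℕ
  isNode : T.IsNode address

/-- The tree order, with the root as the maximal element: `x ≤ y` if `y` is equal to `x` or
an ancestor of `x`. -/
instance (T : PlaneTree) : PartialOrder T.Vertex where
  le x y := y.address <+: x.address
  le_refl x := List.prefix_refl x.address
  le_trans _ _ _ hxy hyz := hyz.trans hxy
  le_antisymm _ _ hxy hyx := Vertex.ext (hyx.eq_of_length_le hxy.length_le)

/-- The root of a plane tree. -/
def root (T : PlaneTree) : T.Vertex := ⟨[], by cases T; simp [IsNode]⟩

/-- Two nodes are incomparable and `x` is to the left of `y`: at their last common ancestor `q`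
they lie below different children `i < j`. -/
def Vertex.LeftOf {T : PlaneTree} (x y : T.Vertex) : Prop :=
  ∃ (q s t : List ℕ) (i j : ℕ), i < j ∧ x.address = q ++ i :: s ∧ y.address = q ++ j :: t

/-- `x` and `y` are children of the same node, and `x` is to the left of `y`. -/
def Vertex.LeftSibling {T : PlaneTree} (x y : T.Vertex) : Prop :=
  ∃ (q : List ℕ) (i j : ℕ), i < j ∧ x.address = q ++ [i] ∧ y.address = q ++ [j]

/-- Plane embeddings of `S` into `T`: the subposets `P` of `T` which are isomorphic to `S` in such
a way that the left-to-right order of the children of each node of `S` is inherited from `T`. -/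
def IsEmbedding (S T : PlaneTree) (P : Set T.Vertex) : Prop :=
  ∃ e : S.Vertex ≃o P, ∀ x y : S.Vertex, x.LeftSibling y → (e x : T.Vertex).LeftOf (e y)

/-- `S ⊆ T`: there is at least one embedding of `S` into `T`. -/
def Embeds (S T : PlaneTree) : Prop :=
  ∃ P : Set T.Vertex, IsEmbedding S T P

/-- The number of nodes. -/
noncomputable def size (T : PlaneTree) : ℕ := Nat.card T.Vertex

/-- The number of all embeddings of `S` into `T`. -/
noncomputable def numAll (T S : PlaneTree) : ℕ :=
  {P : Set T.Vertex | IsEmbedding S T P}.ncard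

/-- The number of good embeddings of `S` into `T`: those which contain the root of `T`. -/
noncomputable def numGood (T S : PlaneTree) : ℕ :=
  {P : Set T.Vertex | IsEmbedding S T P ∧ T.root ∈ P}.ncard

/-- Binary trees: each node has either no child or two children. -/
inductive IsBinary : PlaneTree → Prop where
  | leaf : IsBinary (node [])
  | branch (L R : PlaneTree) : IsBinary L → IsBinary R → IsBinary (node [L, R])

/-- A plane tree has finitely many nodes, so that `size`, `numAll` and `numGood` are
honest cardinalities. -/
instance finite_vertex : ∀ T : PlaneTree, Finite T.Vertex
  | node ts => by
    have ih : ∀ i : Fin ts.length, Finite (ts[i]).Vertex := fun i => finite_vertex (ts[i])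
    let f : Option (Σ i : Fin ts.length, (ts[i]).Vertex) → (node ts).Vertex
      | none => root _
      | some ⟨i, v⟩ => ⟨i :: v.address, by
          rw [IsNode]; exact ⟨i.2, v.isNode⟩⟩
    refine Finite.of_surjective f ?_
    rintro ⟨p, hp⟩
    match p, hp with
    | [], _ => exact ⟨none, rfl⟩
    | i :: p, hp =>
      rw [IsNode] at hp
      obtain ⟨h, hp⟩ := hp
      exact ⟨some ⟨⟨i, h⟩, ⟨p, hp⟩⟩, rfl⟩
termination_by T => T
decreasing_by
  simp_wf
  have := List.sizeOf_lt_of_mem (List.getElem_mem i.2)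
  simp at this ⊢
  omega

lemma size_lt_of_mem {ts : List PlaneTree} {t : PlaneTree} (ht : t ∈ ts) :
    t.size < (node ts).size := by
  obtain ⟨i, hi, rfl⟩ := List.getElem_of_mem ht
  let f : (ts[i]).Vertex → (node ts).Vertex := fun v =>
    ⟨i :: v.address, by rw [IsNode]; exact ⟨hi, v.isNode⟩⟩
  have := Fintype.ofFinite (ts[i]).Vertex
  have := Fintype.ofFinite (node ts).Vertex
  rw [size, size, Nat.card_eq_fintype_card, Nat.card_eq_fintype_card]
  refine Fintype.card_lt_of_injective_of_notMem f (b := root _) ?_ ?_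
  · intro v w h
    have := congrArg Vertex.address h
    exact Vertex.ext (by simpa [f] using this)
  · rintro ⟨v, hv⟩
    have := congrArg Vertex.address hv
    simp [f, root] at this

lemma finite_binary (n : ℕ) : {T : PlaneTree | T.IsBinary ∧ T.size = n}.Finite := by
  suffices h : ∀ n : ℕ, {T : PlaneTree | T.IsBinary ∧ T.size < n}.Finite from
    (h (n + 1)).subset fun T hT => ⟨hT.1, by have := hT.2; omega⟩
  intro n
  induction n with
  | zero => simp
  | succ n ih =>
    refine ((Set.finite_singleton (node [])).union
      (ih.image2 (fun L R => node [L, R]) ih)).subset ?_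
    rintro T ⟨hb, hs⟩
    cases hb with
    | leaf => exact Or.inl rfl
    | branch L R hL hR =>
      have h1 : L.size < (node [L, R]).size := size_lt_of_mem (by simp)
      have h2 : R.size < (node [L, R]).size := size_lt_of_mem (by simp)
      exact Or.inr ⟨L, ⟨hL, by omega⟩, R, ⟨hR, by omega⟩, rfl⟩

/-- The family of plane binary trees with `n` nodes. -/
noncomputable def binaryTrees (n : ℕ) : Finset PlaneTree := (finite_binary n).toFinset

/-- The cumulative number of embeddings of `S` into the plane binary trees with `n` nodes. -/
noncomputable def allB (n : ℕ) (S : PlaneTree) : ℕ := ∑ T ∈ binaryTrees n, numAll T S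

/-- The cumulative number of good embeddings of `S` into the plane binary trees with `n` nodes. -/
noncomputable def goodB (n : ℕ) (S : PlaneTree) : ℕ := ∑ T ∈ binaryTrees n, numGood T S

/-- The quantity `√n · g_{B_n}(S) / a_{B_n}(S)`. -/
noncomputable def scaledRatio (S : PlaneTree) (n : ℕ) : ℝ :=
  Real.sqrt (n : ℝ) * ((goodB n S : ℝ) / (allB n S : ℝ))

/-- The odd `n` tending to infinity. -/
def oddAtTop : Filter ℕ := Filter.atTop ⊓ Filter.principal {n : ℕ | Odd n}

end PlaneTree

/-! The scaled limit depends on S only through its number of nodes plus its number of leaves, the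
`weight` of S, and it is monotone in that number.

Since an embedding is determined by its image, `numAll` counts maps of nodes that preserve "strictly
below" and "to the left of" (`numAll_eq`). Such maps decompose along the root of a binary tree: a
forest sent below the root is cut at some index, one part going to the left subtree and the other to
the right (`forestCard_sum`). Let A and G be the generating functions, by inner nodes, of all and of
good embeddings of S, let B be that of binary trees, and w = √(1 - 4X) = 1 - 2XB. An embedding of S
avoiding the root is a good embedding of S with a new root on top; these are counted by 2XB·A = (1 -
w)A, so G = wA (`sqrtSeries_mul_allGF`). For a forest of k ≥ 1 trees, cutting repeatedly produces
the Catalan recursion and the factor C_{k-1} (X/w)^{k-1} (`sqrtSeries_pow_mul_forestGF`). Induction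
on S then gives XA = c·w^(-p)(1 - w)^q with c > 0 and p + 1 = `weight` (`hasClosedForm`).

The coefficients of w^(-p)(1 - w)^q grow like 4^n n^(p/2 - 1)/Γ(p/2), whatever q is. Multiplying by
w lowers p by one, so the limit is √2·Γ(p/2)/Γ((p - 1)/2), where 1/Γ(0) = 0. It increases with p by
log-convexity of Γ (`gammaRatio_mono`), and p increases along embeddings (`weight_le_of_embeds`). -/

namespace PlaneTree
open Filter Topology PowerSeries

/-! ### Powers of 1 - 4X, coefficient asymptotics and the Gamma quotient. -/

/-- The formal power series of `(1 - 4 * X) ^ (-s)`. -/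
noncomputable def negPowSeries (s : ℝ) : PowerSeries ℝ :=
  rescale (-4 : ℝ) (binomialSeries ℝ (-s))

lemma negPowSeries_add (s t : ℝ) :
    negPowSeries (s + t) = negPowSeries s * negPowSeries t := by
  rw [negPowSeries, neg_add, binomialSeries_add, map_mul]; rfl

lemma negPowSeries_zero : negPowSeries 0 = 1 := by
  simp [negPowSeries]

lemma negPowSeries_neg_one : negPowSeries (-1) = 1 - 4 * X := by
  have h := binomialSeries_nat (R := ℝ) (A := ℝ) 1
  rw [Nat.cast_one, pow_one] at h
  rw [negPowSeries, neg_neg, h, map_add, map_one, rescale_X, map_neg, map_ofNat]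
  ring

lemma constantCoeff_negPowSeries (s : ℝ) : constantCoeff (negPowSeries s) = 1 := by
  rw [← coeff_zero_eq_constantCoeff_apply, negPowSeries, coeff_rescale]
  simp

lemma smeval_descPochhammer_neg (s : ℝ) (n : ℕ) :
    (descPochhammer ℤ n).smeval (-s) = (-1) ^ n * ∏ j ∈ Finset.range n, (s + j) := by
  induction n with
  | zero => simp
  | succ n ih =>
    rw [descPochhammer_succ_right, Polynomial.smeval_mul, ih, Finset.prod_range_succ,
      Polynomial.smeval_sub, Polynomial.smeval_X, Polynomial.smeval_natCast]
    simp only [pow_zero, nsmul_eq_mul, mul_one, pow_succ]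
    ring

lemma coeff_negPowSeries (s : ℝ) (n : ℕ) :
    coeff n (negPowSeries s) = 4 ^ n * ((∏ j ∈ Finset.range n, (s + j)) / n.factorial) := by
  have h := Ring.descPochhammer_eq_factorial_smul_choose (-s) n
  rw [smeval_descPochhammer_neg, nsmul_eq_mul] at h
  have hn : (n.factorial : ℝ) ≠ 0 := by positivity
  have h' : Ring.choose (-s) n = (-1) ^ n * ((∏ j ∈ Finset.range n, (s + j)) / n.factorial) := by
    field_simp
    linarith
  rw [negPowSeries, coeff_rescale, binomialSeries_coeff, h', smul_eq_mul, mul_one, ← mul_assoc,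
    ← mul_pow]
  norm_num

/-- The reciprocal of Γ is entire, so poles must not be excluded: nonpositive s does occur below,
for instance s = (p - 1)/2 with p = 1. -/
lemma tendsto_inv_GammaSeq (s : ℝ) :
    Tendsto (fun n => (Real.GammaSeq s n)⁻¹) atTop (𝓝 (Real.Gamma s)⁻¹) := by
  by_cases hs : Real.Gamma s = 0
  · obtain ⟨m, rfl⟩ := Real.Gamma_eq_zero_iff s |>.1 hs
    rw [hs, inv_zero]
    -- At s = -m the denominator of Euler's product vanishes once n ≥ m; division by zero gives 0,
    -- which is the correct value of 1/Γ.
    refine tendsto_const_nhds.congr' ?_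
    filter_upwards [eventually_ge_atTop m] with n hn
    rw [Real.GammaSeq, Finset.prod_eq_zero (i := m) (by simp; omega) (by simp)]
    simp
  · exact (Real.GammaSeq_tendsto_Gamma s).inv₀ hs

/-- The normalised coefficient is the reciprocal of Euler's product for Γ(s), up to the factor n/(n
+ s). -/
lemma tendsto_coeff_negPowSeries (s : ℝ) :
    Tendsto (fun n : ℕ => coeff n (negPowSeries s) / 4 ^ n * (n : ℝ) ^ (1 - s)) atTop
      (𝓝 (Real.Gamma s)⁻¹) := by
  have h1 : Tendsto (fun n : ℕ => (n : ℝ) / (n + s)) atTop (𝓝 1) :=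
    tendsto_natCast_div_add_atTop s
  have h2 := (tendsto_inv_GammaSeq s).mul h1
  rw [mul_one] at h2
  refine h2.congr' ?_
  have h3 : ∀ᶠ n : ℕ in atTop, -s < n :=
    tendsto_natCast_atTop_atTop.eventually (eventually_gt_atTop (-s))
  filter_upwards [h3, eventually_gt_atTop 0] with n hn hn0
  have hn0' : (0 : ℝ) < n := by exact_mod_cast hn0
  have hs : (n : ℝ) + s ≠ 0 := by linarith
  have hf : (n.factorial : ℝ) ≠ 0 := by positivity
  have hp : (n : ℝ) ^ s ≠ 0 := (Real.rpow_pos_of_pos hn0' s).ne'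
  rw [coeff_negPowSeries, Real.GammaSeq, Finset.prod_range_succ, Real.rpow_sub hn0', Real.rpow_one,
    inv_div, mul_div_cancel_left₀ _ (by positivity)]
  field_simp
  ring

/-- The formal power series of `√(1 - 4 * X)`. -/
noncomputable abbrev sqrtSeries : PowerSeries ℝ := negPowSeries (-1 / 2)

lemma sqrtSeries_sq : sqrtSeries ^ 2 = 1 - 4 * X := by
  rw [sq, ← negPowSeries_add, ← negPowSeries_neg_one]; norm_num

lemma eq_sqrtSeries {w : PowerSeries ℝ} (hw : w ^ 2 = 1 - 4 * X) (h0 : constantCoeff w = 1) :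
    w = sqrtSeries := by
  rw [← sqrtSeries_sq] at hw
  rcases sq_eq_sq_iff_eq_or_eq_neg.1 hw with h | h
  · exact h
  · have := congrArg constantCoeff h
    rw [h0, map_neg, constantCoeff_negPowSeries] at this
    norm_num at this

lemma negPowSeries_mul_sqrtSeries_pow (s : ℝ) (k : ℕ) :
    negPowSeries s * sqrtSeries ^ k = negPowSeries (s - k / 2) := by
  induction k with
  | zero => simp
  | succ k ih =>
    rw [pow_succ, ← mul_assoc, ih, ← negPowSeries_add]
    congr 1
    push_cast
    ring

/-- The factor (1 - w)^q does not affect the leading order: each further factor 1 - w subtracts a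
term with s replaced by s - 1/2, smaller by n^(-1/2). -/
lemma tendsto_coeff_mul_one_sub_sqrtSeries_pow (s : ℝ) (q : ℕ) :
    Tendsto (fun n : ℕ => coeff n (negPowSeries s * (1 - sqrtSeries) ^ q) / 4 ^ n *
      (n : ℝ) ^ (1 - s)) atTop (𝓝 (Real.Gamma s)⁻¹) := by
  induction q generalizing s with
  | zero => simpa using tendsto_coeff_negPowSeries s
  | succ q ih =>
    have h : Tendsto (fun n : ℕ => (n : ℝ) ^ (-(1 / 2 : ℝ))) atTop (𝓝 0) :=
      (tendsto_rpow_neg_atTop (by norm_num)).comp tendsto_natCast_atTop_atTop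
    have h2 := (ih s).sub ((ih (s - 1 / 2)).mul h)
    rw [mul_zero, sub_zero] at h2
    refine h2.congr' ?_
    filter_upwards [eventually_gt_atTop 0] with n hn
    have hn' : (0 : ℝ) < n := by exact_mod_cast hn
    have e : negPowSeries s * (1 - sqrtSeries) ^ (q + 1) =
        negPowSeries s * (1 - sqrtSeries) ^ q -
          negPowSeries (s - 1 / 2) * (1 - sqrtSeries) ^ q := by
      have := negPowSeries_mul_sqrtSeries_pow s 1
      rw [pow_one, Nat.cast_one] at this
      rw [← this]
      ring
    rw [e, map_sub, mul_assoc, ← Real.rpow_add hn']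
    ring_nf

/-- The limit of `√n · [Xⁿ] √(1 - 4X)^(1 - p) (1 - √(1 - 4X))^q / [Xⁿ] √(1 - 4X)^(-p) (1 - √(1 - 4X))^q`. -/
noncomputable def gammaRatio (p : ℕ) : ℝ := Real.Gamma (p / 2) / Real.Gamma ((p - 1) / 2)

lemma tendsto_coeff_ratio {p : ℕ} (hp : 0 < p) (q : ℕ) :
    Tendsto (fun n : ℕ => √n *
      (coeff n (sqrtSeries * (negPowSeries (p / 2) * (1 - sqrtSeries) ^ q)) /
        coeff n (negPowSeries (p / 2) * (1 - sqrtSeries) ^ q))) atTop (𝓝 (gammaRatio p)) := by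
  have hG : Real.Gamma (p / 2) ≠ 0 := (Real.Gamma_pos_of_pos (by positivity)).ne'
  have h := (tendsto_coeff_mul_one_sub_sqrtSeries_pow ((p - 1) / 2) q).div
    (tendsto_coeff_mul_one_sub_sqrtSeries_pow (p / 2) q) (inv_ne_zero hG)
  have e : (Real.Gamma ((p - 1) / 2))⁻¹ / (Real.Gamma (p / 2))⁻¹ = gammaRatio p := by
    rw [gammaRatio, div_inv_eq_mul, mul_comm, ← div_eq_mul_inv]
  rw [e] at h
  refine h.congr' ?_
  filter_upwards [eventually_gt_atTop 0] with n hn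
  have hn' : (0 : ℝ) < n := by exact_mod_cast hn
  have e2 : sqrtSeries * (negPowSeries (p / 2) * (1 - sqrtSeries) ^ q) =
      negPowSeries ((p - 1) / 2) * (1 - sqrtSeries) ^ q := by
    have := negPowSeries_mul_sqrtSeries_pow (p / 2) 1
    rw [pow_one, Nat.cast_one] at this
    rw [sub_div, ← this]
    ring
  have e3 : (n : ℝ) ^ (1 - ((p : ℝ) - 1) / 2) = (n : ℝ) ^ (1 - (p : ℝ) / 2) * √n := by
    rw [Real.sqrt_eq_rpow, ← Real.rpow_add hn']
    congr 1
    ring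
  have hp' : (n : ℝ) ^ (1 - (p : ℝ) / 2) ≠ 0 := (Real.rpow_pos_of_pos hn' _).ne'
  rw [Pi.div_apply, e2, e3]
  field_simp

lemma eventually_coeff_pos {p : ℕ} (hp : 0 < p) (q : ℕ) :
    ∀ᶠ n : ℕ in atTop, 0 < coeff n (negPowSeries (p / 2) * (1 - sqrtSeries) ^ q) := by
  have h := tendsto_coeff_mul_one_sub_sqrtSeries_pow (p / 2) q
  have hG : 0 < (Real.Gamma (p / 2))⁻¹ := inv_pos.2 (Real.Gamma_pos_of_pos (by positivity))
  filter_upwards [h.eventually (lt_mem_nhds hG), eventually_gt_atTop 0] with n hn hn0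
  have hn' : (0 : ℝ) < n := by exact_mod_cast hn0
  have h1 := (pos_iff_pos_of_mul_pos hn).2 (Real.rpow_pos_of_pos hn' _)
  exact (div_pos_iff_of_pos_right (by positivity)).1 h1

lemma gammaRatio_le_succ {p : ℕ} (hp : 0 < p) : gammaRatio p ≤ gammaRatio (p + 1) := by
  -- For p = 1 the denominator is Γ(0), with default value 0, so the quotient is 0. Otherwise
  -- log-convexity at the midpoint gives Γ(p/2)² ≤ Γ((p - 1)/2) Γ((p + 1)/2).
  obtain rfl | hp := Nat.eq_or_lt_of_le hp
  · have h := Real.Gamma_pos_of_pos (show (0 : ℝ) < 1 by norm_num)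
    have h' := Real.Gamma_pos_of_pos (show (0 : ℝ) < 1 / 2 by norm_num)
    simp only [gammaRatio]
    norm_num
    positivity
  · have hp' : (1 : ℝ) < p := by exact_mod_cast hp
    have hs : (0 : ℝ) < (p - 1) / 2 := by linarith
    have ht : (0 : ℝ) < (p + 1) / 2 := by linarith
    have h := Real.Gamma_mul_add_mul_le_rpow_Gamma_mul_rpow_Gamma hs ht
      (a := 1 / 2) (b := 1 / 2) (by norm_num) (by norm_num) (by norm_num)
    have g1 := Real.Gamma_pos_of_pos hs
    have g2 := Real.Gamma_pos_of_pos ht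
    have g3 := Real.Gamma_pos_of_pos (show (0 : ℝ) < p / 2 by linarith)
    rw [show (1 / 2 : ℝ) * ((p - 1) / 2) + 1 / 2 * ((p + 1) / 2) = p / 2 by ring,
      ← Real.sqrt_eq_rpow, ← Real.sqrt_eq_rpow, ← Real.sqrt_mul g1.le] at h
    have h2 := (Real.le_sqrt g3.le (by positivity)).1 h
    simp only [gammaRatio]
    push_cast
    rw [add_sub_cancel_right, div_le_div_iff₀ g1 g3]
    linarith

lemma gammaRatio_mono {p p' : ℕ} (hp : 0 < p) (h : p ≤ p') : gammaRatio p ≤ gammaRatio p' := by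
  induction p', h using Nat.le_induction with
  | base => exact le_rfl
  | succ n hn ih => exact ih.trans (gammaRatio_le_succ (hp.trans_le hn))

end PlaneTree
-- Maps preserving both plane relations, and how they decompose.
namespace PlaneTree

/-- A type with a relation `below` (strict descendant) and a relation `left` (incomparable and
to the left), as on the nodes of a plane tree or of a plane forest. -/
class PlaneRel (α : Type) where
  below : α → α → Prop
  left : α → α → Prop

open PlaneRel

instance (T : PlaneTree) : PlaneRel T.Vertex := ⟨fun x y => x < y, Vertex.LeftOf⟩

instance : PlaneRel Empty := ⟨fun _ _ => False, fun _ _ => False⟩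

/-- A new root is added above everything. -/
instance (α : Type) [PlaneRel α] : PlaneRel (Option α) where
  below
    | some x, some y => below x y
    | some _, none => True
    | none, _ => False
  left
    | some x, some y => left x y
    | _, _ => False

/-- The first summand is to the left of the second one. -/
instance (α β : Type) [PlaneRel α] [PlaneRel β] : PlaneRel (α ⊕ β) where
  below
    | .inl x, .inl y => below x y
    | .inr x, .inr y => below x y
    | _, _ => False
  left
    | .inl x, .inl y => left x y
    | .inr x, .inr y => left x y
    | .inl _, .inr _ => True
    | .inr _, .inl _ => False

section relations
variable {α β : Type} [PlaneRel α] [PlaneRel β]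

@[simp] lemma below_some_some (x y : α) : below (some x) (some y) ↔ below x y := Iff.rfl
@[simp] lemma below_some_none (x : α) : below (some x) none ↔ True := Iff.rfl
@[simp] lemma below_none (x : Option α) : below none x ↔ False := by cases x <;> exact Iff.rfl
@[simp] lemma left_some_some (x y : α) : left (some x) (some y) ↔ left x y := Iff.rfl
@[simp] lemma left_none_right (x : Option α) : left x none ↔ False := by cases x <;> exact Iff.rfl
@[simp] lemma left_none_left (x : Option α) : left none x ↔ False := by cases x <;> exact Iff.rfl
@[simp] lemma below_inl_inl (x y : α) : below (.inl x : α ⊕ β) (.inl y) ↔ below x y := Iff.rfl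
@[simp] lemma below_inr_inr (x y : β) : below (.inr x : α ⊕ β) (.inr y) ↔ below x y := Iff.rfl
@[simp] lemma below_inl_inr (x : α) (y : β) : below (.inl x : α ⊕ β) (.inr y) ↔ False := Iff.rfl
@[simp] lemma below_inr_inl (x : α) (y : β) : below (.inr y : α ⊕ β) (.inl x) ↔ False := Iff.rfl
@[simp] lemma left_inl_inl (x y : α) : left (.inl x : α ⊕ β) (.inl y) ↔ left x y := Iff.rfl
@[simp] lemma left_inr_inr (x y : β) : left (.inr x : α ⊕ β) (.inr y) ↔ left x y := Iff.rfl
@[simp] lemma left_inl_inr (x : α) (y : β) : left (.inl x : α ⊕ β) (.inr y) ↔ True := Iff.rfl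
@[simp] lemma left_inr_inl (x : α) (y : β) : left (.inr y : α ⊕ β) (.inl x) ↔ False := Iff.rfl

end relations

/-- Maps which preserve both relations. -/
@[ext]
structure PlaneHom (α β : Type) [PlaneRel α] [PlaneRel β] : Type where
  toFun : α → β
  map_below : ∀ {x y}, below x y → below (toFun x) (toFun y)
  map_left : ∀ {x y}, left x y → left (toFun x) (toFun y)

/-- Bijections which preserve and reflect both relations. -/
structure PlaneIso (α β : Type) [PlaneRel α] [PlaneRel β] : Type extends α ≃ β where
  below_iff : ∀ {x y}, below (toFun x) (toFun y) ↔ below x y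
  left_iff : ∀ {x y}, left (toFun x) (toFun y) ↔ left x y

namespace PlaneHom
variable {α α' β β' γ : Type} [PlaneRel α] [PlaneRel β] [PlaneRel α'] [PlaneRel β'] [PlaneRel γ]

lemma toFun_injective : Function.Injective (toFun : PlaneHom α β → α → β) :=
  fun _ _ h => PlaneHom.ext h

instance [Finite α] [Finite β] : Finite (PlaneHom α β) := Finite.of_injective _ toFun_injective

/-- Composition with isomorphisms. -/
def congr (e : PlaneIso α α') (e' : PlaneIso β β') : PlaneHom α β ≃ PlaneHom α' β' where
  toFun f := ⟨fun x => e'.toEquiv (f.toFun (e.toEquiv.symm x)),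
    fun h => e'.below_iff.2 (f.map_below (e.below_iff.1 (by simpa using h))),
    fun h => e'.left_iff.2 (f.map_left (e.left_iff.1 (by simpa using h)))⟩
  invFun f := ⟨fun x => e'.toEquiv.symm (f.toFun (e.toEquiv x)),
    fun h => e'.below_iff.1 (by simpa using f.map_below (e.below_iff.2 h)),
    fun h => e'.left_iff.1 (by simpa using f.map_left (e.left_iff.2 h))⟩
  left_inv f := by ext; simp
  right_inv f := by ext; simp

end PlaneHom

/-- The number of maps which preserve both relations. -/
noncomputable def homCard (α β : Type) [PlaneRel α] [PlaneRel β] : ℕ := Nat.card (PlaneHom α β)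

/-- The identity. -/
def PlaneIso.refl (α : Type) [PlaneRel α] : PlaneIso α α := ⟨Equiv.refl α, Iff.rfl, Iff.rfl⟩

/-- Associativity of ordered sums. -/
def PlaneIso.sumAssoc (α β γ : Type) [PlaneRel α] [PlaneRel β] [PlaneRel γ] :
    PlaneIso ((α ⊕ β) ⊕ γ) (α ⊕ (β ⊕ γ)) where
  toEquiv := Equiv.sumAssoc α β γ
  below_iff := by rintro ((x | x) | x) ((y | y) | y) <;> simp
  left_iff := by rintro ((x | x) | x) ((y | y) | y) <;> simp

/-- The empty forest is neutral on the right. -/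
def PlaneIso.sumEmpty (α : Type) [PlaneRel α] : PlaneIso (α ⊕ Empty) α where
  toEquiv := Equiv.sumEmpty α Empty
  below_iff := by rintro (x | ⟨⟨⟩⟩) (y | ⟨⟨⟩⟩); simp
  left_iff := by rintro (x | ⟨⟨⟩⟩) (y | ⟨⟨⟩⟩); simp

/-- The empty forest is neutral on the left. -/
def PlaneIso.emptySum (α : Type) [PlaneRel α] : PlaneIso (Empty ⊕ α) α where
  toEquiv := Equiv.emptySum Empty α
  below_iff := by rintro (⟨⟨⟩⟩ | x) (⟨⟨⟩⟩ | y); simp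
  left_iff := by rintro (⟨⟨⟩⟩ | x) (⟨⟨⟩⟩ | y); simp

section counting
variable {α α' β β' γ : Type} [PlaneRel α] [PlaneRel β] [PlaneRel α'] [PlaneRel β'] [PlaneRel γ]

lemma homCard_congr (e : PlaneIso α α') (e' : PlaneIso β β') : homCard α β = homCard α' β' :=
  Nat.card_congr (PlaneHom.congr e e')

lemma ncard_eq_card_of_range {X Y : Type} {f : X → Y} (hf : Function.Injective f) {s : Set Y}
    (hs : ∀ y, y ∈ s ↔ ∃ x, f x = y) : s.ncard = Nat.card X := by
  have : s = Set.range f := Set.ext hs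
  rw [this, ← Nat.card_coe_set_eq, Nat.card_range_of_injective hf]

lemma homCard_empty : homCard Empty β = 1 := by
  have : Unique (PlaneHom Empty β) :=
    { default := ⟨fun x => x.elim, fun {x} => x.elim, fun {x} => x.elim⟩
      uniq := fun f => PlaneHom.ext (funext fun x => x.elim) }
  exact Nat.card_unique

lemma homCard_to_empty [Nonempty α] : homCard α Empty = 0 := by
  have : IsEmpty (PlaneHom α Empty) := ⟨fun f => (f.toFun (Classical.arbitrary α)).elim⟩
  exact Nat.card_of_isEmpty

lemma ncard_hom_avoiding_root :
    {f : PlaneHom α (Option β) | ∀ x, f.toFun x ≠ none}.ncard = homCard α β := by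
  refine ncard_eq_card_of_range (f := fun g : PlaneHom α β =>
    (⟨fun x => some (g.toFun x), fun h => g.map_below h, fun h => g.map_left h⟩ :
      PlaneHom α (Option β))) ?_ fun f => ⟨fun hf => ?_, ?_⟩
  · intro g g' h
    ext x
    simpa using congrFun (congrArg PlaneHom.toFun h) x
  · choose g hg using fun x => Option.ne_none_iff_exists'.1 (hf x)
    refine ⟨⟨g, fun {x y} h => ?_, fun {x y} h => ?_⟩, ?_⟩
    · simpa [hg] using f.map_below h
    · simpa [hg] using f.map_left h
    · ext x : 2
      exact (hg x).symm
  · rintro ⟨g, rfl⟩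
    simp

lemma ncard_hom_root_to_root :
    {f : PlaneHom (Option α) (Option β) | f.toFun none = none}.ncard = homCard α β := by
  refine ncard_eq_card_of_range (f := fun g : PlaneHom α β =>
    (⟨Option.map g.toFun, fun {x y} h => ?_, fun {x y} h => ?_⟩ :
      PlaneHom (Option α) (Option β))) ?_ fun f => ⟨fun hf => ?_, ?_⟩
  · rcases x with _ | x <;> rcases y with _ | y <;> simp_all [g.map_below]
  · rcases x with _ | x <;> rcases y with _ | y <;> simp_all [g.map_left]
  · intro g g' h
    ext x
    simpa using congrFun (congrArg PlaneHom.toFun h) (some x)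
  · have hf' : f.toFun none = none := hf
    have h : ∀ x, ∃ y, f.toFun (some x) = some y := fun x => by
      have := f.map_below (below_some_none x |>.2 trivial)
      rw [hf'] at this
      cases h : f.toFun (some x) with
      | none => simp [h] at this
      | some y => exact ⟨y, rfl⟩
    choose g hg using h
    refine ⟨⟨g, fun {x y} h => ?_, fun {x y} h => ?_⟩, ?_⟩
    · simpa [hg] using f.map_below (below_some_some x y |>.2 h)
    · simpa [hg] using f.map_left (left_some_some x y |>.2 h)
    · ext x : 2
      cases x with
      | none => exact hf'.symm
      | some x => exact (hg x).symm
  · rintro ⟨g, rfl⟩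
    simp

/-- If the source root misses the target root, so does every node below it, and the whole map lands
in `β`. -/
lemma homCard_option_option [Finite α] [Finite β] :
    homCard (Option α) (Option β) = homCard α β + homCard (Option α) β := by
  rw [homCard, ← Set.ncard_univ, ← Set.ncard_inter_add_ncard_sdiff_eq_ncard Set.univ
    {f : PlaneHom (Option α) (Option β) | f.toFun none = none} Set.finite_univ,
    Set.univ_inter, ncard_hom_root_to_root, ← ncard_hom_avoiding_root (α := Option α)]
  congr 2
  ext f
  simp only [Set.mem_sdiff, Set.mem_univ, true_and, Set.mem_ofPred_eq]
  refine ⟨fun h x => ?_, fun h => h none⟩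
  cases x with
  | none => exact h
  | some x =>
    intro hx
    have := f.map_below (below_some_none x |>.2 trivial)
    simp [hx] at this

/-- Every source node is to the left or right of another one, whereas the target root is in no
left-right relation, so it is never hit. -/
lemma homCard_sum_option [Nonempty α] [Nonempty β] :
    homCard (α ⊕ β) (Option γ) = homCard (α ⊕ β) γ := by
  rw [← ncard_hom_avoiding_root (α := α ⊕ β) (β := γ), homCard, ← Set.ncard_univ]
  refine congrArg Set.ncard (Set.ext fun f => ?_)
  simp only [Set.mem_univ, Set.mem_ofPred_eq, true_iff]
  rintro (x | x) hx
  · have := f.map_left (left_inl_inr x (Classical.arbitrary β) |>.2 trivial)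
    simp [hx] at this
  · have := f.map_left (left_inl_inr (Classical.arbitrary α) x |>.2 trivial)
    simp [hx] at this

lemma ncard_hom_sum_sum :
    {f : PlaneHom (α ⊕ α') (β ⊕ β') | (∀ x, (f.toFun (.inl x)).isLeft) ∧
      ∀ x, (f.toFun (.inr x)).isRight}.ncard = homCard α β * homCard α' β' := by
  rw [homCard, homCard, ← Nat.card_prod]
  refine ncard_eq_card_of_range (f := fun g : PlaneHom α β × PlaneHom α' β' =>
    (⟨Sum.map g.1.toFun g.2.toFun, fun {x y} h => ?_, fun {x y} h => ?_⟩ :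
      PlaneHom (α ⊕ α') (β ⊕ β'))) ?_ fun f => ⟨fun hf => ?_, ?_⟩
  · rcases x with x | x <;> rcases y with y | y <;> simp_all [PlaneHom.map_below]
  · rcases x with x | x <;> rcases y with y | y <;> simp_all [PlaneHom.map_left]
  · rintro ⟨g1, g2⟩ ⟨g1', g2'⟩ h
    have h' := fun x => congrFun (congrArg PlaneHom.toFun h) x
    ext x
    · simpa using h' (.inl x)
    · simpa using h' (.inr x)
  · obtain ⟨h1, h2⟩ := hf
    choose g1 hg1 using fun x => Sum.isLeft_iff.1 (h1 x)
    choose g2 hg2 using fun x => Sum.isRight_iff.1 (h2 x)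
    refine ⟨⟨⟨g1, fun {x y} h => ?_, fun {x y} h => ?_⟩,
      ⟨g2, fun {x y} h => ?_, fun {x y} h => ?_⟩⟩, ?_⟩
    · simpa [hg1] using f.map_below (below_inl_inl (β := α') x y |>.2 h)
    · simpa [hg1] using f.map_left (left_inl_inl (β := α') x y |>.2 h)
    · simpa [hg2] using f.map_below (below_inr_inr (α := α) x y |>.2 h)
    · simpa [hg2] using f.map_left (left_inr_inr (α := α) x y |>.2 h)
    · ext x : 2
      cases x with
      | inl x => exact (hg1 x).symm
      | inr x => exact (hg2 x).symm
  · rintro ⟨g, rfl⟩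
    simp

end counting

/-! ### Cutting a forest between two ordered summands. -/

/-- The nodes of a plane forest. -/
def ForestVertex : List PlaneTree → Type
  | [] => Empty
  | s :: F => s.Vertex ⊕ ForestVertex F

instance ForestVertex.planeRel : ∀ F, PlaneRel (ForestVertex F)
  | [] => inferInstanceAs (PlaneRel Empty)
  | s :: F =>
    letI := ForestVertex.planeRel F
    inferInstanceAs (PlaneRel (s.Vertex ⊕ ForestVertex F))

instance ForestVertex.finite : ∀ F, Finite (ForestVertex F)
  | [] => inferInstanceAs (Finite Empty)
  | s :: F =>
    letI := ForestVertex.finite F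
    inferInstanceAs (Finite (s.Vertex ⊕ ForestVertex F))

lemma below_root {T : PlaneTree} {x : T.Vertex} (hx : x ≠ T.root) : below x T.root :=
  lt_of_le_of_ne (List.nil_prefix : [] <+: x.address) hx

section split
variable {α β γ : Type} [PlaneRel α] [PlaneRel β] [PlaneRel γ]

lemma below_isLeft {x y : α ⊕ β} (h : below x y) : x.isLeft = y.isLeft := by
  rcases x with x | x <;> rcases y with y | y <;> simp_all

lemma left_isRight {x y : α ⊕ β} (h : left x y) (hx : x.isRight) : y.isRight := by
  rcases x with x | x <;> rcases y with y | y <;> simp_all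

/-- The number of maps from a forest which preserve both relations. -/
noncomputable def forestCard (F : List PlaneTree) (β : Type) [PlaneRel β] : ℕ :=
  homCard (ForestVertex F) β

/-- The number of maps from `α` followed by a forest which preserve both relations. -/
noncomputable def sumForestCard (α : Type) [PlaneRel α] (F : List PlaneTree) (β : Type)
    [PlaneRel β] : ℕ :=
  homCard (α ⊕ ForestVertex F) β

lemma sumForestCard_nil : sumForestCard α [] β = homCard α β :=
  homCard_congr (PlaneIso.sumEmpty α) (PlaneIso.refl β)

lemma sumForestCard_cons (s : PlaneTree) (F : List PlaneTree) :
    sumForestCard (α ⊕ s.Vertex) F β = sumForestCard α (s :: F) β :=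
  homCard_congr (PlaneIso.sumAssoc α s.Vertex (ForestVertex F)) (PlaneIso.refl β)

/-- A tree lies on the side of its root, and once a tree goes right so do all later ones; hence a
map is a cut of `F` with a map on each part. The summand `α` accumulates the trees already sent
left, which makes the induction work. -/
lemma ncard_hom_forest_sum [Finite α] [Finite β] [Finite γ] (F : List PlaneTree) :
    {f : PlaneHom (α ⊕ ForestVertex F) (β ⊕ γ) | ∀ x, (f.toFun (.inl x)).isLeft}.ncard =
      ∑ i ∈ Finset.range (F.length + 1),
        sumForestCard α (F.take i) β * forestCard (F.drop i) γ := by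
  induction F generalizing α with
  | nil =>
    have h := ncard_hom_sum_sum (α := α) (α' := ForestVertex []) (β := β) (β' := γ)
    have e : ∀ f : PlaneHom (α ⊕ ForestVertex []) (β ⊕ γ),
        ∀ x, (f.toFun (.inr x)).isRight := fun f x => Empty.elim x
    simp only [e, implies_true, and_true] at h
    rw [h]
    simp only [List.length_nil, zero_add, Finset.sum_range_one, List.take_nil, List.drop_nil,
      sumForestCard_nil]
    rfl
  | cons s F ih =>
    rw [List.length_cons, Finset.sum_range_succ']
    simp only [List.take_succ_cons, List.drop_succ_cons, List.take_zero, List.drop_zero,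
      sumForestCard_nil, ← sumForestCard_cons]
    -- Case split on the root of `s`: on the left, `s` joins `α`; on the right, the whole forest
    -- goes right, which is the term i = 0.
    rw [← ih (α := α ⊕ s.Vertex), forestCard, ← ncard_hom_sum_sum, ← Set.ncard_inter_add_ncard_sdiff_eq_ncard
      {f : PlaneHom (α ⊕ ForestVertex (s :: F)) (β ⊕ γ) | ∀ x, (f.toFun (.inl x)).isLeft}
      {f | (f.toFun (.inr (.inl s.root))).isLeft} (Set.toFinite _)]
    congr 1
    · rw [← Set.ncard_image_of_injective _ (PlaneHom.congr (PlaneIso.sumAssoc α s.Vertex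
        (ForestVertex F)) (PlaneIso.refl (β ⊕ γ))).injective]
      refine congrArg Set.ncard (Set.ext fun f => ?_)
      rw [Equiv.image_eq_preimage_symm]
      constructor
      · rintro ⟨h1, h2⟩ (x | x)
        · exact h1 x
        · change (f.toFun (.inr (.inl x))).isLeft
          obtain rfl | hx := eq_or_ne x s.root
          · exact h2
          · have : below (.inr (.inl x) : α ⊕ ForestVertex (s :: F)) (.inr (.inl s.root)) :=
              below_root hx
            rw [below_isLeft (f.map_below this)]
            exact h2
      · exact fun h => ⟨fun x => h (.inl x), h (.inr s.root)⟩
    · refine congrArg Set.ncard (Set.ext fun f => ?_)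
      constructor
      · rintro ⟨h1, h2⟩
        refine ⟨h1, ?_⟩
        have h2' : (f.toFun (.inr (.inl s.root))).isRight := by simpa using h2
        rintro (x | x)
        · obtain rfl | hx := eq_or_ne x s.root
          · exact h2'
          · have : below (.inr (.inl x) : α ⊕ ForestVertex (s :: F)) (.inr (.inl s.root)) :=
              below_root hx
            rw [← Sum.not_isLeft, below_isLeft (f.map_below this), Sum.not_isLeft]
            exact h2'
        · exact left_isRight (f.map_left (x := .inr (.inl s.root)) (y := .inr (.inr x)) trivial) h2'
      · exact fun h => ⟨h.1, by simpa using h.2 (.inl s.root)⟩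

lemma forestCard_sum [Finite β] [Finite γ] (F : List PlaneTree) :
    forestCard F (β ⊕ γ) = ∑ i ∈ Finset.range (F.length + 1),
      forestCard (F.take i) β * forestCard (F.drop i) γ := by
  have h := ncard_hom_forest_sum (α := Empty) (β := β) (γ := γ) F
  have e : ∀ f : PlaneHom (Empty ⊕ ForestVertex F) (β ⊕ γ),
      ∀ x, (f.toFun (.inl x)).isLeft := fun f x => Empty.elim x
  simp only [e, implies_true] at h
  rw [forestCard, ← homCard_congr (PlaneIso.emptySum (ForestVertex F)) (PlaneIso.refl (β ⊕ γ)), homCard,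
    ← Set.ncard_univ]
  refine h.trans (Finset.sum_congr rfl fun i _ => ?_)
  rw [sumForestCard,
    homCard_congr (PlaneIso.emptySum (ForestVertex (F.take i))) (PlaneIso.refl β)]
  rfl

end split

end PlaneTree
-- Addresses, and embeddings as relation-preserving maps.
namespace PlaneTree
open PlaneRel

section addresses

/-- The address `p` is a proper extension of `q`. -/
def AddrBelow (p q : List ℕ) : Prop := q <+: p ∧ p ≠ q

/-- The address `p` lies to the left of `q`. -/
def AddrLeft (p q : List ℕ) : Prop :=
  ∃ (r s t : List ℕ) (i j : ℕ), i < j ∧ p = r ++ i :: s ∧ q = r ++ j :: t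

lemma addrBelow_cons {i j : ℕ} {p q : List ℕ} :
    AddrBelow (i :: p) (j :: q) ↔ i = j ∧ AddrBelow p q := by
  simp only [AddrBelow, List.cons_prefix_cons, ne_eq, List.cons.injEq]
  grind

lemma addrLeft_cons {i j : ℕ} {p q : List ℕ} :
    AddrLeft (i :: p) (j :: q) ↔ i < j ∨ i = j ∧ AddrLeft p q := by
  constructor
  · rintro ⟨r, s, t, a, b, hab, h1, h2⟩
    cases r with
    | nil => simp_all
    | cons c r =>
      simp only [List.cons_append, List.cons.injEq] at h1 h2
      exact Or.inr ⟨h1.1.trans h2.1.symm, r, s, t, a, b, hab, h1.2, h2.2⟩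
  · rintro (h | ⟨rfl, r, s, t, a, b, hab, rfl, rfl⟩)
    · exact ⟨[], p, q, i, j, h, rfl, rfl⟩
    · exact ⟨i :: r, s, t, a, b, hab, rfl, rfl⟩

lemma not_addrLeft_nil_left {p : List ℕ} : ¬ AddrLeft [] p := by
  rintro ⟨r, s, t, a, b, _, h, _⟩
  simp at h

lemma not_addrLeft_nil_right {p : List ℕ} : ¬ AddrLeft p [] := by
  rintro ⟨r, s, t, a, b, _, _, h⟩
  simp at h

lemma addr_trichotomy (p q : List ℕ) :
    p = q ∨ AddrBelow p q ∨ AddrBelow q p ∨ AddrLeft p q ∨ AddrLeft q p := by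
  induction p generalizing q with
  | nil => cases q <;> simp [AddrBelow]
  | cons i p ih =>
    cases q with
    | nil => simp [AddrBelow]
    | cons j q =>
      have := ih q
      simp only [addrBelow_cons, addrLeft_cons, List.cons.injEq]
      rcases lt_trichotomy i j with h | h | h <;> grind

lemma not_prefix_of_addrLeft {p q : List ℕ} (h : AddrLeft p q) : ¬ q <+: p ∧ ¬ p <+: q := by
  obtain ⟨r, s, t, a, b, hab, rfl, rfl⟩ := h
  simp [List.prefix_append_right_inj, hab.ne, hab.ne']

lemma AddrLeft.append {p q : List ℕ} (h : AddrLeft p q) (u v : List ℕ) :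
    AddrLeft (p ++ u) (q ++ v) := by
  obtain ⟨r, s, t, a, b, hab, rfl, rfl⟩ := h
  exact ⟨r, s ++ u, t ++ v, a, b, hab, by simp, by simp⟩

lemma addrLeft_lt {p q : List ℕ} (h : AddrLeft p q) : p < q := by
  obtain ⟨r, s, t, a, b, hab, rfl, rfl⟩ := h
  exact List.append_left_lt (List.cons_lt_cons_iff.2 (Or.inl hab))

lemma addrBelow_lt {p q : List ℕ} (h : AddrBelow p q) : q < p := by
  obtain ⟨⟨s, rfl⟩, h⟩ := h
  cases s with
  | nil => simp at h
  | cons a s =>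
    have : q ++ [] < q ++ a :: s := List.append_left_lt (List.nil_lt_cons a s)
    simpa using this

end addresses

section vertices
variable {S T : PlaneTree}

lemma below_iff {x y : T.Vertex} : below x y ↔ AddrBelow x.address y.address := by
  change x < y ↔ _
  rw [lt_iff_le_and_ne, AddrBelow, ne_eq, ne_eq, Vertex.ext_iff]
  rfl

lemma left_iff {x y : T.Vertex} : left x y ↔ AddrLeft x.address y.address := Iff.rfl

lemma isNode_cons {F : List PlaneTree} {i : ℕ} {p : List ℕ} :
    (node F).IsNode (i :: p) ↔ ∃ h : i < F.length, (F[i]).IsNode p := by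
  rw [IsNode]

lemma isNode_nil (T : PlaneTree) : T.IsNode [] := T.root.isNode

lemma IsNode.of_append {p q : List ℕ} (h : T.IsNode (p ++ q)) : T.IsNode p := by
  induction p generalizing T with
  | nil => exact isNode_nil T
  | cons i p ih =>
    obtain ⟨F⟩ := T
    rw [List.cons_append, isNode_cons] at h
    obtain ⟨hi, h⟩ := h
    exact isNode_cons.2 ⟨hi, ih h⟩

/-- The index of the tree of a forest to which a node belongs, and its address there. -/
def ForestVertex.address : ∀ {F : List PlaneTree}, ForestVertex F → ℕ × List ℕ
  | _ :: _, .inl v => (0, v.address)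
  | _ :: _, .inr x => ((ForestVertex.address x).1 + 1, (ForestVertex.address x).2)

lemma ForestVertex.isNode : ∀ {F : List PlaneTree} (x : ForestVertex F),
    (node F).IsNode (x.address.1 :: x.address.2)
  | _ :: _, .inl v => isNode_cons.2 ⟨by simp [address], by simpa [address] using v.isNode⟩
  | _ :: _, .inr x => by
    obtain ⟨h, h'⟩ := isNode_cons.1 x.isNode
    exact isNode_cons.2 ⟨by simpa [address] using h, by simpa [address] using h'⟩

lemma ForestVertex.exists_address : ∀ (F : List PlaneTree) (i : ℕ) (p : List ℕ),
    (node F).IsNode (i :: p) → ∃ x : ForestVertex F, x.address = (i, p)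
  | [], i, p, h => by
    obtain ⟨h, -⟩ := isNode_cons.1 h
    simp at h
  | s :: F, 0, p, h => by
    obtain ⟨_, h'⟩ := isNode_cons.1 h
    exact ⟨.inl ⟨p, h'⟩, rfl⟩
  | s :: F, i + 1, p, h => by
    obtain ⟨hi, h⟩ := isNode_cons.1 h
    obtain ⟨x, hx⟩ := exists_address F i p (isNode_cons.2 ⟨by simpa using hi, h⟩)
    exact ⟨.inr x, by simp [address, hx]⟩

lemma ForestVertex.address_injective : ∀ {F : List PlaneTree},
    Function.Injective (ForestVertex.address (F := F))
  | _ :: _, .inl v, .inl w, h => by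
    simp only [address, Prod.mk.injEq, true_and] at h
    rw [Vertex.ext h]
  | _ :: _, .inl v, .inr y, h => by simp [address] at h
  | _ :: _, .inr x, .inl w, h => by simp [address] at h
  | _ :: _, .inr x, .inr y, h => by
    simp only [address, Prod.mk.injEq, Nat.add_right_cancel_iff] at h
    rw [address_injective (Prod.ext h.1 h.2)]

lemma ForestVertex.below_iff : ∀ {F : List PlaneTree} {x y : ForestVertex F},
    below x y ↔ AddrBelow (x.address.1 :: x.address.2) (y.address.1 :: y.address.2)
  | _ :: _, .inl v, .inl w => by
    simp only [address, addrBelow_cons, true_and]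
    exact PlaneTree.below_iff
  | _ :: _, .inl v, .inr y => by
    simp only [address, addrBelow_cons]
    exact iff_of_false id (by simp)
  | _ :: _, .inr x, .inl w => by
    simp only [address, addrBelow_cons]
    exact iff_of_false id (by simp)
  | _ :: _, .inr x, .inr y => by
    have := ForestVertex.below_iff (x := x) (y := y)
    simp only [address, addrBelow_cons, Nat.add_right_cancel_iff] at this ⊢
    exact this

lemma ForestVertex.left_iff : ∀ {F : List PlaneTree} {x y : ForestVertex F},
    left x y ↔ AddrLeft (x.address.1 :: x.address.2) (y.address.1 :: y.address.2)
  | _ :: _, .inl v, .inl w => by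
    simp only [address, addrLeft_cons, true_and, lt_irrefl, false_or]
    exact PlaneTree.left_iff
  | _ :: _, .inl v, .inr y => by
    simp only [address, addrLeft_cons]
    exact iff_of_true trivial (by simp)
  | _ :: _, .inr x, .inl w => by
    simp only [address, addrLeft_cons]
    exact iff_of_false id (by simp)
  | _ :: _, .inr x, .inr y => by
    have := ForestVertex.left_iff (x := x) (y := y)
    simp only [address, addrLeft_cons, Nat.add_right_cancel_iff, Nat.add_lt_add_iff_right]
      at this ⊢
    exact this

/-- The nodes of a tree are its root and the nodes of the forest of the subtrees below it. -/
noncomputable def vertexIso (F : List PlaneTree) :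
    PlaneIso (Option (ForestVertex F)) (node F).Vertex where
  toEquiv := Equiv.ofBijective
    (fun x => x.elim (root _) fun y => ⟨y.address.1 :: y.address.2, y.isNode⟩) <| by
      constructor
      · rintro (_ | x) (_ | y) h
        · rfl
        · simp [root] at h
        · simp [root] at h
        · simp only [Option.elim_some, Vertex.mk.injEq, List.cons.injEq] at h
          rw [ForestVertex.address_injective (Prod.ext h.1 h.2)]
      · rintro ⟨_ | ⟨i, p⟩, hp⟩
        · exact ⟨none, rfl⟩
        · obtain ⟨x, hx⟩ := ForestVertex.exists_address F i p hp
          exact ⟨some x, by simp [hx]⟩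
  below_iff := by
    rintro (_ | x) (_ | y)
    · simp [below_iff, AddrBelow]
    · simp [below_iff, AddrBelow, root]
    · simp [below_iff, AddrBelow, root]
    · exact PlaneTree.below_iff.trans ForestVertex.below_iff.symm
  left_iff := by
    rintro (_ | x) (_ | y)
    · simp [left_iff, root, not_addrLeft_nil_left]
    · simp [left_iff, root, not_addrLeft_nil_left]
    · simp [left_iff, root, not_addrLeft_nil_right]
    · exact PlaneTree.left_iff.trans ForestVertex.left_iff.symm

lemma vertexIso_none (F : List PlaneTree) : (vertexIso F).toEquiv none = (node F).root := rfl

/-- Any two nodes are equal, comparable or left-right related, and these cases exclude each other in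
the target; so preservation implies reflection. -/
lemma PlaneHom.le_iff (f : PlaneHom S.Vertex T.Vertex) {x y : S.Vertex} :
    f.toFun x ≤ f.toFun y ↔ x ≤ y := by
  constructor
  · intro h
    rcases addr_trichotomy x.address y.address with h' | h' | h' | h' | h'
    · exact (Vertex.ext h').le
    · exact h'.1
    · exact absurd (f.map_below (below_iff.2 h')) (not_lt_of_ge h)
    · exact absurd h (not_prefix_of_addrLeft (f.map_left (left_iff.2 h'))).1
    · exact absurd h (not_prefix_of_addrLeft (f.map_left (left_iff.2 h'))).2
  · intro h
    obtain rfl | h := h.eq_or_lt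
    · exact le_rfl
    · exact (show f.toFun x < f.toFun y from f.map_below h).le

lemma isEmbedding_iff {P : Set T.Vertex} :
    IsEmbedding S T P ↔ ∃ f : PlaneHom S.Vertex T.Vertex, Set.range f.toFun = P := by
  constructor
  · rintro ⟨e, he⟩
    refine ⟨⟨fun x => e x, fun {x y} h => ?_, fun {x y} h => ?_⟩, ?_⟩
    · exact (e.lt_iff_lt.2 (show x < y from h) : e x < e y)
    · obtain ⟨r, s, t, i, j, hij, hx, hy⟩ := h
      -- Sibling order suffices: pass to the sibling ancestors of x and y below their last common
      -- ancestor, then extend the image addresses.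
      have hx' : S.IsNode (r ++ [i]) := IsNode.of_append (q := s) (by simpa [← hx] using x.isNode)
      have hy' : S.IsNode (r ++ [j]) := IsNode.of_append (q := t) (by simpa [← hy] using y.isNode)
      have h := he ⟨_, hx'⟩ ⟨_, hy'⟩ ⟨r, i, j, hij, rfl, rfl⟩
      have h1 : e x ≤ e ⟨_, hx'⟩ := e.le_iff_le.2 (⟨s, by simp [hx]⟩ : r ++ [i] <+: x.address)
      have h2 : e y ≤ e ⟨_, hy'⟩ := e.le_iff_le.2 (⟨t, by simp [hy]⟩ : r ++ [j] <+: y.address)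
      obtain ⟨u, hu⟩ : (e ⟨_, hx'⟩ : T.Vertex).address <+: (e x : T.Vertex).address := h1
      obtain ⟨v, hv⟩ : (e ⟨_, hy'⟩ : T.Vertex).address <+: (e y : T.Vertex).address := h2
      change AddrLeft (e x : T.Vertex).address (e y : T.Vertex).address
      rw [← hu, ← hv]
      exact AddrLeft.append h u v
    · ext y
      constructor
      · rintro ⟨x, rfl⟩
        exact (e x).2
      · exact fun hy => ⟨e.symm ⟨y, hy⟩, by simp⟩
  · rintro ⟨f, rfl⟩
    let f' : S.Vertex ↪o T.Vertex := OrderEmbedding.ofMapLEIff f.toFun fun _ _ => f.le_iff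
    refine ⟨f'.orderIso, fun x y h => ?_⟩
    obtain ⟨q, i, j, hij, hx, hy⟩ := h
    exact f.map_left ⟨q, [], [], i, j, hij, hx, hy⟩

/-- Both relations are compatible with the lexicographic order of addresses, so each map is strictly
increasing on a finite chain and is determined by its range. -/
lemma range_toFun_injective :
    Function.Injective fun f : PlaneHom S.Vertex T.Vertex => Set.range f.toFun := by
  intro f g h
  let ι : {p // S.IsNode p} → S.Vertex := fun p => ⟨p.1, p.2⟩
  have hι : Function.Surjective ι := fun v => ⟨⟨v.address, v.isNode⟩, rfl⟩
  have : Finite {p // S.IsNode p} := Finite.of_injective ι fun p q h =>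
    Subtype.ext (congrArg Vertex.address h)
  have hm : ∀ f : PlaneHom S.Vertex T.Vertex, StrictMono fun p => (f.toFun (ι p)).address := by
    intro f p q hpq
    rcases addr_trichotomy p.1 q.1 with h' | h' | h' | h' | h'
    · exact absurd hpq (Subtype.ext h').not_lt
    · exact absurd hpq (not_lt_of_gt (addrBelow_lt h'))
    · exact addrBelow_lt (below_iff.1 (f.map_below (x := ι q) (y := ι p) (below_iff.2 h')))
    · exact addrLeft_lt (f.map_left (x := ι p) (y := ι q) h')
    · exact absurd hpq (not_lt_of_gt (addrLeft_lt h'))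
  have hr : ∀ f : PlaneHom S.Vertex T.Vertex,
      (Set.range fun p => (f.toFun (ι p)).address) = Vertex.address '' Set.range f.toFun := by
    intro f
    rw [← hι.range_comp, ← Set.range_comp]
    rfl
  have e := ((hm f).range_inj (hm g)).1 (by rw [hr, hr]; exact congrArg _ h)
  ext v : 2
  obtain ⟨p, rfl⟩ := hι v
  exact Vertex.ext (congrFun e p)

lemma numAll_eq : numAll T S = homCard S.Vertex T.Vertex :=
  ncard_eq_card_of_range range_toFun_injective fun _ => isEmbedding_iff

lemma numGood_eq (F G : List PlaneTree) :
    numGood (node G) (node F) = forestCard F (ForestVertex G) := by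
  rw [forestCard, ← ncard_hom_root_to_root, ← Set.ncard_image_of_injective _
    (PlaneHom.congr (vertexIso F) (vertexIso G)).injective,
    ← Set.ncard_image_of_injective _ range_toFun_injective, numGood]
  refine congrArg Set.ncard (Set.ext fun P => ?_)
  rw [Equiv.image_eq_preimage_symm, Set.mem_image]
  have key : ∀ f : PlaneHom (node F).Vertex (node G).Vertex,
      ((PlaneHom.congr (vertexIso F) (vertexIso G)).symm f).toFun none = none ↔
        (node G).root ∈ Set.range f.toFun := by
    intro f
    change (vertexIso G).toEquiv.symm (f.toFun ((vertexIso F).toEquiv none)) = none ↔ _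
    rw [Equiv.symm_apply_eq, vertexIso_none, vertexIso_none]
    refine ⟨fun h => ⟨_, h⟩, fun ⟨x, hx⟩ => ?_⟩
    have h1 : f.toFun x ≤ f.toFun (node F).root := f.le_iff.2 (List.nil_prefix : [] <+: x.address)
    refine le_antisymm (List.nil_prefix : [] <+: (f.toFun (node F).root).address) ?_
    rwa [hx] at h1
  constructor
  · rintro ⟨h1, h2⟩
    obtain ⟨f, rfl⟩ := isEmbedding_iff.1 h1
    exact ⟨f, (key f).2 h2, rfl⟩
  · rintro ⟨f, h1, rfl⟩
    exact ⟨isEmbedding_iff.2 ⟨f, rfl⟩, (key f).1 h1⟩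

end vertices

end PlaneTree
-- The weight and its monotonicity.
namespace PlaneTree
open PlaneRel

section weight

/-- The nodes with nothing below them. -/
def leaves (α : Type) [PlaneRel α] : Set α := {x | ∀ y, ¬ below y x}

/-- The number of nodes plus the number of leaves. -/
noncomputable def weight (α : Type) [PlaneRel α] : ℕ := Nat.card α + (leaves α).ncard

variable {α β : Type} [PlaneRel α] [PlaneRel β]

lemma weight_congr (e : PlaneIso α β) : weight α = weight β := by
  rw [weight, weight, Nat.card_congr e.toEquiv, ← Set.ncard_image_of_injective _ e.injective]
  congr 2
  ext y
  rw [Equiv.image_eq_preimage_symm]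
  constructor
  · intro h z hz
    exact h (e.toEquiv.symm z) (e.below_iff.1 (by simpa using hz))
  · intro h z hz
    exact h (e.toEquiv z) (by simpa using e.below_iff.2 hz)

lemma weight_sum [Finite α] [Finite β] : weight (α ⊕ β) = weight α + weight β := by
  have h : leaves (α ⊕ β) = Sum.inl '' leaves α ∪ Sum.inr '' leaves β := by
    ext (x | x) <;> simp [leaves]
  rw [weight, h, Set.ncard_union_eq _ (Set.toFinite _) (Set.toFinite _), Nat.card_sum,
    Set.ncard_image_of_injective _ Sum.inl_injective,
    Set.ncard_image_of_injective _ Sum.inr_injective, weight, weight]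
  · omega
  · rw [Set.disjoint_left]
    rintro _ ⟨x, _, rfl⟩ ⟨y, _, h⟩
    cases h

lemma weight_option_of_isEmpty [IsEmpty α] : weight (Option α) = 2 := by
  have : leaves (Option α) = {none} := by
    ext (_ | x)
    · simp [leaves, Option.forall]
    · exact isEmptyElim x
  rw [weight, this, Set.ncard_singleton, Finite.card_option, Nat.card_of_isEmpty]

lemma weight_option [Finite α] [Nonempty α] : weight (Option α) = weight α + 1 := by
  have : leaves (Option α) = some '' leaves α := by
    ext (_ | x) <;> simp [leaves, Option.forall]
  rw [weight, this, Set.ncard_image_of_injective _ (Option.some_injective α), Finite.card_option,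
    weight]
  omega

lemma weight_forestVertex (F : List PlaneTree) :
    weight (ForestVertex F) = (F.map fun s => weight s.Vertex).sum := by
  induction F with
  | nil =>
    change weight Empty = 0
    simp [weight, leaves]
  | cons s F ih =>
    rw [List.map_cons, List.sum_cons, ← ih]
    exact weight_sum

instance : IsEmpty (ForestVertex []) := inferInstanceAs (IsEmpty Empty)

instance (s : PlaneTree) (F : List PlaneTree) : Nonempty (ForestVertex (s :: F)) :=
  ⟨.inl s.root⟩

lemma weight_node_nil : weight (node []).Vertex = 2 := by
  rw [← weight_congr (vertexIso []), weight_option_of_isEmpty]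

lemma weight_node_cons (s : PlaneTree) (F : List PlaneTree) :
    weight (node (s :: F)).Vertex = ((s :: F).map fun s => weight s.Vertex).sum + 1 := by
  rw [← weight_congr (vertexIso (s :: F)), weight_option, weight_forestVertex]

/-- For the leaf count, choose a leaf of `T` below the image of each leaf of `S`. Equal choices
would make the two images comparable, hence also the two leaves, which are then equal. -/
lemma weight_le_of_embeds {S T : PlaneTree} (h : Embeds S T) :
    weight S.Vertex ≤ weight T.Vertex := by
  obtain ⟨_, hP⟩ := h
  obtain ⟨f, -⟩ := isEmbedding_iff.1 hP
  have hf : Function.Injective f.toFun := fun x y hxy =>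
    le_antisymm (f.le_iff.1 hxy.le) (f.le_iff.1 hxy.ge)
  refine Nat.add_le_add (Nat.card_le_card_of_injective _ hf) ?_
  have h : ∀ x : S.Vertex, ∃ y : T.Vertex, y ≤ f.toFun x ∧ y ∈ leaves T.Vertex := fun x => by
    obtain ⟨y, hy, hm⟩ := exists_minimal_le_of_wellFoundedLT (fun _ : T.Vertex => True)
      (f.toFun x) trivial
    exact ⟨y, hy, fun z hz => not_le_of_gt hz (hm.2 trivial (le_of_lt hz))⟩
  choose g hg hg' using h
  refine Set.ncard_le_ncard_of_injOn g (fun x _ => hg' x) (fun x hx y hy hxy => ?_) (Set.toFinite _)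
  have h1 : (f.toFun x).address <+: (g x).address := hg x
  have h2 : (f.toFun y).address <+: (g x).address := by rw [hxy]; exact hg y
  rcases List.prefix_or_prefix_of_prefix h1 h2 with h | h
  · have : y ≤ x := f.le_iff.1 h
    obtain rfl | h := this.eq_or_lt
    · rfl
    · exact absurd h (hx y)
  · have : x ≤ y := f.le_iff.1 h
    obtain rfl | h := this.eq_or_lt
    · rfl
    · exact absurd h (hy x)

end weight

/-! ### Recursions at the root of the target tree. -/

section recursion

lemma numGood_leaf (F : List PlaneTree) :
    numGood (node []) (node F) = if F = [] then 1 else 0 := by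
  rw [numGood_eq]
  cases F with
  | nil => exact homCard_empty
  | cons s F => exact homCard_to_empty (α := ForestVertex (s :: F))

lemma numGood_branch (F : List PlaneTree) (L R : PlaneTree) :
    numGood (node [L, R]) (node F) = ∑ i ∈ Finset.range (F.length + 1),
      forestCard (F.take i) L.Vertex * forestCard (F.drop i) R.Vertex := by
  rw [numGood_eq]
  refine (forestCard_sum (β := L.Vertex) (γ := ForestVertex [R]) F).trans ?_
  refine Finset.sum_congr rfl fun i _ => ?_
  congr 1
  exact homCard_congr (PlaneIso.refl _) (PlaneIso.sumEmpty R.Vertex)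

lemma forestCard_nil (T : PlaneTree) : forestCard [] T.Vertex = 1 := homCard_empty

lemma forestCard_singleton (S T : PlaneTree) : forestCard [S] T.Vertex = numAll T S := by
  rw [numAll_eq]
  exact homCard_congr (PlaneIso.sumEmpty S.Vertex) (PlaneIso.refl _)

lemma numAll_node (F G : List PlaneTree) :
    numAll (node G) (node F) = numGood (node G) (node F) + numGood (node G) (node [node F]) := by
  rw [numAll_eq, numGood_eq, numGood_eq, ← homCard_congr (vertexIso F) (vertexIso G),
    homCard_option_option, homCard_congr (vertexIso F) (PlaneIso.refl (ForestVertex G))]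
  congr 1
  exact (homCard_congr (PlaneIso.sumEmpty (node F).Vertex) (PlaneIso.refl _)).symm

lemma forestCard_cons_cons (s t : PlaneTree) (F : List PlaneTree) (T : PlaneTree) :
    forestCard (s :: t :: F) T.Vertex = numGood T (node (s :: t :: F)) := by
  obtain ⟨G⟩ := T
  rw [numGood_eq, forestCard, ← homCard_congr (PlaneIso.refl _) (vertexIso G)]
  have : Nonempty s.Vertex := ⟨s.root⟩
  exact homCard_sum_option (α := s.Vertex) (β := ForestVertex (t :: F))

lemma size_leaf : (node []).size = 1 := by
  rw [size, ← Nat.card_congr (vertexIso []).toEquiv, Finite.card_option, Nat.card_of_isEmpty]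

lemma size_branch (L R : PlaneTree) : (node [L, R]).size = L.size + R.size + 1 := by
  rw [size, ← Nat.card_congr (vertexIso [L, R]).toEquiv, Finite.card_option]
  change Nat.card (L.Vertex ⊕ (R.Vertex ⊕ Empty)) + 1 = _
  rw [Nat.card_sum, Nat.card_sum, Nat.card_of_isEmpty (α := Empty), size, size, add_zero]

end recursion

end PlaneTree
-- Generating functions and the closed form.
namespace PlaneTree
open PowerSeries Filter Topology

section generatingFunctions

/-- The generating function of the sums of `φ` over the binary trees with `m` inner nodes. -/
noncomputable def genFun (φ : PlaneTree → ℕ) : PowerSeries ℝ :=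
  PowerSeries.mk fun m => ((∑ T ∈ binaryTrees (2 * m + 1), φ T : ℕ) : ℝ)

lemma mem_binaryTrees {n : ℕ} {T : PlaneTree} : T ∈ binaryTrees n ↔ T.IsBinary ∧ T.size = n := by
  simp [binaryTrees]

lemma IsBinary.odd_size {T : PlaneTree} (hT : T.IsBinary) : Odd T.size := by
  induction hT with
  | leaf => rw [size_leaf]; exact odd_one
  | branch L R _ _ hL hR =>
    rw [size_branch]
    exact (hL.add_odd hR).add_one

lemma binaryTrees_one : binaryTrees 1 = {node []} := by
  ext T
  rw [mem_binaryTrees, Finset.mem_singleton]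
  constructor
  · rintro ⟨hT, h⟩
    cases hT with
    | leaf => rfl
    | branch L R hL hR =>
      rw [size_branch] at h
      have := hL.odd_size.pos
      omega
  · rintro rfl
    exact ⟨.leaf, size_leaf⟩

lemma sum_binaryTrees_succ (m : ℕ) (φ : PlaneTree → ℕ) :
    ∑ T ∈ binaryTrees (2 * (m + 1) + 1), φ T = ∑ ab ∈ Finset.HasAntidiagonal.antidiagonal m,
      ∑ LR ∈ binaryTrees (2 * ab.1 + 1) ×ˢ binaryTrees (2 * ab.2 + 1), φ (node [LR.1, LR.2]) := by
  rw [Finset.sum_sigma']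
  symm
  refine Finset.sum_bij (fun x _ => node [x.2.1, x.2.2]) ?_ ?_ ?_ fun _ _ => rfl
  · rintro ⟨⟨a, b⟩, L, R⟩ h
    simp only [Finset.mem_sigma, Finset.HasAntidiagonal.mem_antidiagonal, Finset.mem_product,
      mem_binaryTrees] at h
    obtain ⟨h, ⟨hL, hL'⟩, hR, hR'⟩ := h
    refine mem_binaryTrees.2 ⟨.branch L R hL hR, ?_⟩
    dsimp only
    rw [size_branch, hL', hR', ← h]
    ring
  · rintro ⟨⟨a, b⟩, L, R⟩ h ⟨⟨a', b'⟩, L', R'⟩ h' e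
    simp only [Finset.mem_sigma, Finset.HasAntidiagonal.mem_antidiagonal, Finset.mem_product,
      mem_binaryTrees] at h h'
    simp only [node.injEq, List.cons.injEq, and_true] at e
    obtain ⟨rfl, rfl⟩ := e
    obtain rfl : a = a' := by omega
    obtain rfl : b = b' := by omega
    rfl
  · intro T hT
    obtain ⟨hT, h⟩ := mem_binaryTrees.1 hT
    cases hT with
    | leaf => rw [size_leaf] at h; omega
    | branch L R hL hR =>
      rw [size_branch] at h
      obtain ⟨a, ha⟩ := hL.odd_size
      obtain ⟨b, hb⟩ := hR.odd_size
      refine ⟨⟨(a, b), L, R⟩, ?_, rfl⟩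
      simp only [Finset.mem_sigma, Finset.HasAntidiagonal.mem_antidiagonal, Finset.mem_product, mem_binaryTrees]
      exact ⟨by omega, ⟨hL, ha⟩, hR, hb⟩

lemma genFun_eq {φ : PlaneTree → ℕ} {k : ℕ} {α β : ℕ → PlaneTree → ℕ}
    (h : ∀ L R, φ (node [L, R]) = ∑ i ∈ Finset.range k, α i L * β i R) :
    genFun φ = C (φ (node []) : ℝ) +
      X * ∑ i ∈ Finset.range k, genFun (α i) * genFun (β i) := by
  ext m
  cases m with
  | zero => simp [genFun, binaryTrees_one]
  | succ m =>
    rw [map_add, coeff_succ_X_mul, coeff_C, if_neg (Nat.succ_ne_zero m), zero_add, map_sum,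
      genFun, coeff_mk, sum_binaryTrees_succ]
    simp only [coeff_mul, genFun, coeff_mk, h]
    rw [Finset.sum_comm]
    push_cast
    refine Finset.sum_congr rfl fun ab _ => ?_
    rw [Finset.sum_comm]
    refine Finset.sum_congr rfl fun i _ => ?_
    rw [Finset.sum_mul_sum, Finset.sum_product]

/-- The generating function of the embeddings of a forest. -/
noncomputable def forestGF (F : List PlaneTree) : PowerSeries ℝ :=
  genFun fun T => forestCard F T.Vertex

/-- The generating function of all embeddings. -/
noncomputable def allGF (S : PlaneTree) : PowerSeries ℝ := genFun fun T => numAll T S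

/-- The generating function of the good embeddings. -/
noncomputable def goodGF (S : PlaneTree) : PowerSeries ℝ := genFun fun T => numGood T S

lemma goodGF_node (F : List PlaneTree) :
    goodGF (node F) = (if F = [] then 1 else 0) +
      X * ∑ i ∈ Finset.range (F.length + 1), forestGF (F.take i) * forestGF (F.drop i) := by
  rw [goodGF, genFun_eq (numGood_branch F), numGood_leaf]
  congr 1
  split_ifs <;> simp

lemma forestGF_nil : forestGF [] = 1 + X * (forestGF [] * forestGF []) := by
  conv_lhs => rw [forestGF, genFun_eq (k := 1) (α := fun _ T => forestCard [] T.Vertex)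
    (β := fun _ T => forestCard [] T.Vertex) (by simp [forestCard_nil])]
  simp [forestCard_nil, forestGF]

lemma forestGF_singleton (S : PlaneTree) : forestGF [S] = allGF S := by
  simp only [forestGF, forestCard_singleton, allGF]

lemma sqrtSeries_eq : sqrtSeries = 1 - 2 * X * forestGF [] := by
  symm
  apply eq_sqrtSeries
  · linear_combination 4 * X * forestGF_nil.symm
  · simp

lemma genFun_add (φ ψ : PlaneTree → ℕ) : genFun (fun T => φ T + ψ T) = genFun φ + genFun ψ := by
  ext m
  simp [genFun, Finset.sum_add_distrib]

lemma goodGF_node_singleton (S : PlaneTree) :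
    goodGF (node [S]) = (1 - sqrtSeries) * allGF S := by
  rw [goodGF_node, sqrtSeries_eq, List.length_singleton, Finset.sum_range_succ,
    Finset.sum_range_one]
  simp only [List.take_zero, List.drop_zero, List.take_succ_cons, List.drop_succ_cons,
    forestGF_singleton, List.cons_ne_nil, if_false]
  ring

lemma sqrtSeries_mul_allGF (S : PlaneTree) : sqrtSeries * allGF S = goodGF S := by
  obtain ⟨F⟩ := S
  have h : allGF (node F) = goodGF (node F) + goodGF (node [node F]) := by
    rw [allGF, goodGF, goodGF, ← genFun_add]
    congr 1
    ext T
    obtain ⟨G⟩ := T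
    exact numAll_node F G
  rw [goodGF_node_singleton] at h
  linear_combination h

lemma forestGF_cons_cons (s t : PlaneTree) (F : List PlaneTree) :
    forestGF (s :: t :: F) = goodGF (node (s :: t :: F)) := by
  simp only [forestGF, goodGF, forestCard_cons_cons]

/-- The two trivial cuts contribute 2XB times the unknown series; moving them to the left produces w
= 1 - 2XB, and only proper cuts remain. -/
lemma sqrtSeries_mul_forestGF (s t : PlaneTree) (F : List PlaneTree) :
    sqrtSeries * forestGF (s :: t :: F) = X * ∑ i ∈ Finset.range (F.length + 1),
      forestGF ((s :: t :: F).take (i + 1)) * forestGF ((s :: t :: F).drop (i + 1)) := by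
  have h := goodGF_node (s :: t :: F)
  rw [← forestGF_cons_cons, if_neg (List.cons_ne_nil _ _), zero_add, Finset.sum_range_succ',
    List.length_cons, List.length_cons, Finset.sum_range_succ, List.take_zero, List.drop_zero,
    List.take_of_length_le (by simp), List.drop_of_length_le (by simp)] at h
  rw [sqrtSeries_eq]
  linear_combination h

/-- Proper cuts split n + 1 trees recursively in two, so binary bracketings are counted; each of the
n cuts costs a factor X/w. -/
lemma sqrtSeries_pow_mul_forestGF (n : ℕ) (F : List PlaneTree) (hF : F.length = n + 1) :
    sqrtSeries ^ n * forestGF F = (catalan n : PowerSeries ℝ) * X ^ n * (F.map allGF).prod := by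
  induction n using Nat.strong_induction_on generalizing F with
  | _ n ih =>
    match n, F, hF with
    | 0, [s], _ => simp [forestGF_singleton]
    | n + 1, s :: t :: F, hF =>
      have hn : F.length = n := by simpa using hF
      have e : ∀ i ∈ Finset.range (n + 1), sqrtSeries ^ n *
          (forestGF ((s :: t :: F).take (i + 1)) * forestGF ((s :: t :: F).drop (i + 1))) =
          ((catalan i * catalan (n - i) : ℕ) : PowerSeries ℝ) * (X ^ n * ((s :: t :: F).map allGF).prod) := by
        intro i hi
        have hi : i ≤ n := by simpa [Nat.lt_succ_iff] using hi
        have h1 := ih i (by omega) ((s :: t :: F).take (i + 1)) (by simp; omega)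
        have h2 := ih (n - i) (by omega) ((s :: t :: F).drop (i + 1)) (by simp; omega)
        have h3 : (((s :: t :: F).take (i + 1)).map allGF).prod *
            (((s :: t :: F).drop (i + 1)).map allGF).prod = ((s :: t :: F).map allGF).prod := by
          rw [← List.prod_append, ← List.map_append, List.take_append_drop]
        have h4 : sqrtSeries ^ n = sqrtSeries ^ i * sqrtSeries ^ (n - i) := by
          rw [← pow_add, Nat.add_sub_cancel' hi]
        have h5 : (X : PowerSeries ℝ) ^ n = X ^ i * X ^ (n - i) := by
          rw [← pow_add, Nat.add_sub_cancel' hi]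
        rw [h4, h5, ← h3, mul_mul_mul_comm, h1, h2, Nat.cast_mul]
        ring
      rw [pow_succ, mul_assoc, sqrtSeries_mul_forestGF, mul_left_comm, hn, Finset.mul_sum,
        Finset.sum_congr rfl e, ← Finset.sum_mul, ← Nat.cast_sum, catalan_succ,
        Finset.sum_range]
      ring

/-- The generating function of the embeddings of `S` is, up to a constant and a power of `X`, equal
to `w ^ (-p) * (1 - w) ^ q` where `w = √(1 - 4 * X)`. -/
def HasClosedForm (S : PlaneTree) : Prop :=
  ∃ (p q : ℕ) (c : ℝ), 0 < p ∧ 0 < c ∧ p + 1 = weight S.Vertex ∧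
    X * allGF S * sqrtSeries ^ p = C c * (1 - sqrtSeries) ^ q

lemma exists_prod_closedForm (F : List PlaneTree) (hF : ∀ s ∈ F, HasClosedForm s) :
    ∃ (p q : ℕ) (c : ℝ), 0 < c ∧ p + F.length = (F.map fun s => weight s.Vertex).sum ∧
      X ^ F.length * (F.map allGF).prod * sqrtSeries ^ p = C c * (1 - sqrtSeries) ^ q := by
  induction F with
  | nil => exact ⟨0, 0, 1, one_pos, by simp, by simp⟩
  | cons s F ih =>
    obtain ⟨p, q, c, hc, hp, h⟩ := ih fun t ht => hF t (List.mem_cons_of_mem s ht)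
    obtain ⟨p', q', c', -, hc', hp', h'⟩ := hF s List.mem_cons_self
    refine ⟨p' + p, q' + q, c' * c, mul_pos hc' hc, ?_, ?_⟩
    · rw [List.map_cons, List.sum_cons, ← hp, ← hp', List.length_cons]
      ring
    · have := congrArg₂ (· * ·) h' h
      rw [List.map_cons, List.prod_cons, List.length_cons, map_mul]
      linear_combination this

lemma hasClosedForm (S : PlaneTree) : HasClosedForm S := by
  induction h : S.size using Nat.strong_induction_on generalizing S with
  | _ n ih =>
    obtain ⟨F⟩ := S
    have hF : ∀ s ∈ F, HasClosedForm s := fun s hs => ih _ (h ▸ size_lt_of_mem hs) s rfl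
    have hA := sqrtSeries_mul_allGF (node F)
    match F, hF, hA with
    | [], _, hA =>
      -- For a single node G = B, so A = B/w, and XB = (1 - w)/2.
      refine ⟨1, 1, 1 / 2, one_pos, by norm_num, weight_node_nil.symm, ?_⟩
      rw [goodGF_node, if_pos rfl, List.length_nil, zero_add, Finset.sum_range_one, List.take_nil,
        List.drop_nil, ← forestGF_nil] at hA
      have h2 : (C (1 / 2 : ℝ) : PowerSeries ℝ) * 2 = 1 := by
        rw [← map_ofNat C 2, ← map_mul]
        norm_num
      linear_combination X * hA - X * forestGF [] * h2 + C (1 / 2 : ℝ) * sqrtSeries_eq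
    | [s], hF, hA =>
      obtain ⟨p, q, c, hp, hc, hw, h⟩ := hF s List.mem_cons_self
      refine ⟨p + 1, q + 1, c, p.succ_pos, hc, ?_, ?_⟩
      · rw [weight_node_cons, List.map_singleton, List.sum_singleton, hw]
      · rw [goodGF_node_singleton] at hA
        linear_combination X * sqrtSeries ^ p * hA + (1 - sqrtSeries) * h
    | s :: t :: F, hF, hA =>
      obtain ⟨p, q, c, hc, hw, h⟩ := exists_prod_closedForm _ hF
      have hcat : (0 : ℝ) < catalan (F.length + 1) := by
        rw [catalan_eq_centralBinom_div]
        exact_mod_cast Nat.div_pos (Nat.le_of_dvd (Nat.centralBinom_pos _)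
          (Nat.succ_dvd_centralBinom _)) (Nat.succ_pos _)
      refine ⟨p + (F.length + 2), q, catalan (F.length + 1) * c, by omega, mul_pos hcat hc, ?_, ?_⟩
      · rw [weight_node_cons, ← hw]
        rfl
      · have h2 := sqrtSeries_pow_mul_forestGF (F.length + 1) (s :: t :: F) rfl
        rw [← forestGF_cons_cons] at hA
        rw [List.length_cons, List.length_cons] at h
        rw [map_mul, map_natCast]
        linear_combination X * sqrtSeries ^ (p + F.length + 1) * hA +
          X * sqrtSeries ^ p * h2 + (catalan (F.length + 1) : PowerSeries ℝ) * h

lemma exists_X_mul_allGF_eq (S : PlaneTree) : ∃ (p q : ℕ) (c : ℝ), 0 < p ∧ 0 < c ∧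
    p + 1 = weight S.Vertex ∧
    X * allGF S = C c * (negPowSeries (p / 2) * (1 - sqrtSeries) ^ q) := by
  obtain ⟨p, q, c, hp, hc, hw, h⟩ := hasClosedForm S
  refine ⟨p, q, c, hp, hc, hw, ?_⟩
  have e := negPowSeries_mul_sqrtSeries_pow (p / 2) p
  rw [sub_self, negPowSeries_zero] at e
  linear_combination negPowSeries (p / 2) * h - X * allGF S * e

end generatingFunctions

/-! ### Passage to odd n. -/

section limits

lemma tendsto_oddAtTop {β : Type*} {u : ℕ → β} {l : Filter β}
    (h : Tendsto (fun m => u (2 * m + 1)) atTop l) : Tendsto u oddAtTop l := by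
  intro s hs
  obtain ⟨N, hN⟩ := eventually_atTop.1 (h.eventually hs)
  rw [mem_map, oddAtTop, mem_inf_principal]
  filter_upwards [eventually_ge_atTop (2 * N + 1)] with n hn hodd
  obtain ⟨m, rfl⟩ := hodd
  exact hN m (by omega)

lemma exists_tendsto_scaledRatio (S : PlaneTree) : ∃ p, 0 < p ∧ p + 1 = weight S.Vertex ∧
    (∀ᶠ n in oddAtTop, 0 < allB n S) ∧
    Tendsto (scaledRatio S) oddAtTop (𝓝 (√2 * gammaRatio p)) := by
  obtain ⟨p, q, c, hp, hc, hw, h⟩ := exists_X_mul_allGF_eq S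
  have hall : ∀ m : ℕ, (allB (2 * m + 1) S : ℝ) =
      c * coeff (m + 1) (negPowSeries (p / 2) * (1 - sqrtSeries) ^ q) := fun m => by
    rw [← coeff_C_mul, ← h, coeff_succ_X_mul, allGF, genFun, coeff_mk, allB]
  have hgood : ∀ m : ℕ, (goodB (2 * m + 1) S : ℝ) =
      c * coeff (m + 1) (sqrtSeries * (negPowSeries (p / 2) * (1 - sqrtSeries) ^ q)) := fun m => by
    rw [← coeff_C_mul, mul_left_comm, ← h, mul_left_comm, coeff_succ_X_mul, sqrtSeries_mul_allGF,
      goodGF, genFun, coeff_mk, goodB]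
  -- With `u := id` this transfers an eventual property of 2m + 1 to `oddAtTop`.
  refine ⟨p, hp, hw, tendsto_oddAtTop (u := id) (l := Filter.map (fun m => 2 * m + 1) atTop)
    tendsto_map ?_, tendsto_oddAtTop ?_⟩
  · have hev := (tendsto_add_atTop_nat 1).eventually (eventually_coeff_pos hp q)
    refine mem_map.2 ?_
    filter_upwards [hev] with m hm
    have : (0 : ℝ) < allB (2 * m + 1) S := by
      rw [hall]
      exact mul_pos hc hm
    exact_mod_cast this
  · have h1 := (tendsto_coeff_ratio hp q).comp (tendsto_add_atTop_nat 1)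
    -- The factor X in XA shifts the coefficient index to m + 1, and 2m + 1 = (2 - 1/(m + 1))(m +
    -- 1); this is the source of √2.
    have h2 : Tendsto (fun m : ℕ => √(2 - 1 / ((m : ℝ) + 1))) atTop (𝓝 √2) := by
      have := (tendsto_const_nhds (x := (2 : ℝ))).sub (tendsto_one_div_add_atTop_nhds_zero_nat)
      rw [sub_zero] at this
      exact (Real.continuous_sqrt.tendsto 2).comp this
    refine (h2.mul h1).congr fun m => ?_
    have hm : (0 : ℝ) < (m : ℝ) + 1 := by positivity
    have e : ((2 * m + 1 : ℕ) : ℝ) = (2 - 1 / ((m : ℝ) + 1)) * ((m + 1 : ℕ) : ℝ) := by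
      push_cast
      field_simp
      ring
    rw [scaledRatio, hall, hgood, mul_div_mul_left _ _ hc.ne', e, Real.sqrt_mul' _ (by positivity),
      mul_assoc]
    rfl

end limits

end PlaneTree

theorem mainTheorem3 (S₁ S₂ : PlaneTree) (hS : PlaneTree.Embeds S₁ S₂) :
    (∀ᶠ n in PlaneTree.oddAtTop, 0 < PlaneTree.allB n S₁ ∧ 0 < PlaneTree.allB n S₂) ∧
    ∃ L₁ L₂ : ℝ,
      Filter.Tendsto (PlaneTree.scaledRatio S₁) PlaneTree.oddAtTop (nhds L₁) ∧
      Filter.Tendsto (PlaneTree.scaledRatio S₂) PlaneTree.oddAtTop (nhds L₂) ∧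
      L₁ ≤ L₂ := by
  obtain ⟨p₁, hp₁, hw₁, h₁, ht₁⟩ := PlaneTree.exists_tendsto_scaledRatio S₁
  obtain ⟨p₂, hp₂, hw₂, h₂, ht₂⟩ := PlaneTree.exists_tendsto_scaledRatio S₂
  have hp : p₁ ≤ p₂ := by
    have := PlaneTree.weight_le_of_embeds hS
    omega
  exact ⟨h₁.and h₂, _, _, ht₁, ht₂,
    mul_le_mul_of_nonneg_left (PlaneTree.gammaRatio_mono hp₁ hp) (Real.sqrt_nonneg 2)⟩
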